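/- Let $k$ be an algebraically closed field (of arbitrary characteristic) and let $A$ be an abelian variety over $k$. A coset in $A$ is a translate of an abelian subvariety of $A$; it is proper if it is not equal to $A$. Define the homomorphism $\mathrm{Diff}\colon A^3\to A^2$ by $\mathrm{Diff}(P_0,P_1,P_2)=(P_1-P_0,\,P_2-P_0)$. Let $C\subset A$ be an irreducible closed curve that is not contained in any proper coset in $A$ and with $C\neq A$. Let $H\subsetneq A$ be an abelian subvariety not equal to $A$, and let $\psi\colon A\to H$ be a homomorphism such that the restriction $\psi|_H\colon H\to H$ is an isogeny. Let $\psi\times\psi\colon A^2\to H^2$ be its square, and let $B$ be an abelian subvariety of $A^2$ contained in the kernel of $\psi\times\psi$. Let $Z$ be an irreducible closed subvariety of $H^2$ (regarded as a subvariety of $A^2$) and let $Q_1,Q_2\in A(k)$ be such that $$Z+B+(Q_1,Q_2)\subset \mathrm{Diff}(C^3).$$ Then for every $P\in C(k)$ we have $$(C-P)^2\not\subset Z+B+(Q_1,Q_2),$$ where $(C-P)^2=(C-P)\times(C-P)\subset A^2$. -/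

import Mathlib

open CategoryTheory Limits MonoidalCategory CartesianMonoidalCategory MonObj AlgebraicGeometry
open scoped Pointwise

universe u

namespace FaltingsZhang

variable {k : Type u} [Field k]

/-- A group scheme over a field `k` is an abelian variety if it is proper and geometrically
integral over `k`.  As everywhere for group objects in Mathlib, the (commutative) group law is
written multiplicatively. -/
class IsAbelianVariety (A : Over (Spec (.of k))) [GrpObj A] : Prop where
  isProper : IsProper A.hom
  geometricallyIntegral : GeometricallyIntegral A.hom

/-- The group (if `X` is a group scheme) of `k`-rational points of a `k`-scheme `X`. -/
abbrev KPoint (X : Over (Spec (.of k))) : Type u := 𝟙_ (Over (Spec (.of k))) ⟶ X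

/-- The map on `k`-points induced by a morphism of `k`-schemes. -/
noncomputable def onPoints {X Y : Over (Spec (.of k))} (f : X ⟶ Y) (P : KPoint X) : KPoint Y := P ≫ f

/-- `V(k)`, for a subset `V` of the underlying space of the `k`-scheme `X`: the `k`-points of `X`
that lie on `V`. -/
def kPoints {X : Over (Spec (.of k))} (V : Set X.left) : Set (KPoint X) :=
  {P | P.left (IsLocalRing.closedPoint k) ∈ V}

/-- The underlying (closed) set of an irreducible closed subvariety. -/
structure IsClosedSubvariety {X : Over (Spec (.of k))} (V : Set X.left) : Prop where
  isClosed : IsClosed V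
  isIrreducible : IsIrreducible V

/-- An irreducible closed curve. -/
structure IsClosedCurve {X : Over (Spec (.of k))} (V : Set X.left) : Prop
    extends IsClosedSubvariety V where
  dim_eq_one : topologicalKrullDim V = 1

/-- `S` is the set of `k`-points of an abelian subvariety of the group scheme `A`, i.e. the image
on `k`-points of a homomorphism from an abelian variety that is a closed immersion. -/
def IsAbelianSubvariety {A : Over (Spec (.of k))} [GrpObj A] (S : Set (KPoint A)) : Prop :=
  ∃ (G : Over (Spec (.of k))) (_ : GrpObj G) (_ : IsAbelianVariety G) (j : G ⟶ A),
    IsMonHom j ∧ IsClosedImmersion j.left ∧ S = Set.range (onPoints j)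

/-- A coset is a translate of an abelian subvariety. -/
def IsCoset {A : Over (Spec (.of k))} [GrpObj A] (S : Set (KPoint A)) : Prop :=
  ∃ (T : Set (KPoint A)) (P : KPoint A), IsAbelianSubvariety T ∧ S = T * {P}

/-- A coset is proper if it is not the whole ambient abelian variety. -/
def IsProperCoset {A : Over (Spec (.of k))} [GrpObj A] (S : Set (KPoint A)) : Prop :=
  IsCoset S ∧ S ≠ Set.univ

/-- An isogeny: a surjective homomorphism whose (scheme-theoretic) kernel is finite over `k`. -/
structure IsIsogeny {G H : Over (Spec (.of k))} [GrpObj G] [GrpObj H] (f : G ⟶ H) : Prop where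
  isMonHom : IsMonHom f
  surjective : Surjective f.left
  isFinite_ker : IsFinite (pullback.snd f.left η[H].left)

/-- The point `(P, Q)` of `X × Y`. -/
noncomputable def kPair {X Y : Over (Spec (.of k))} (P : KPoint X) (Q : KPoint Y) : KPoint (X ⊗ Y) := lift P Q

/-- The product `S × T`, as a set of `k`-points of `X × Y`. -/
def prodSet {X Y : Over (Spec (.of k))} (S : Set (KPoint X)) (T : Set (KPoint Y)) :
    Set (KPoint (X ⊗ Y)) :=
  Set.image2 kPair S T

/-- The Faltings-Zhang morphism `A³ ⟶ A²`; in additive notation it is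
`(P₀, P₁, P₂) ↦ (P₁ - P₀, P₂ - P₀)`. -/
noncomputable def Diff (A : Over (Spec (.of k))) [GrpObj A] : A ⊗ (A ⊗ A) ⟶ A ⊗ A :=
  lift ((snd A (A ⊗ A) ≫ fst A A) / fst A (A ⊗ A)) ((snd A (A ⊗ A) ≫ snd A A) / fst A (A ⊗ A))

/-- `(C - P)²` (in additive notation). -/
def translateSq {A : Over (Spec (.of k))} [GrpObj A] (C : Set A.left) (P : KPoint A) :
    Set (KPoint (A ⊗ A)) :=
  prodSet (kPoints C * {P⁻¹}) (kPoints C * {P⁻¹})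

/-- `Diff(C³)`. -/
def diffCube {A : Over (Spec (.of k))} [GrpObj A] (C : Set A.left) : Set (KPoint (A ⊗ A)) :=
  onPoints (Diff A) '' prodSet (kPoints C) (prodSet (kPoints C) (kPoints C))

end FaltingsZhang

open FaltingsZhang

/-! Additively, put W = Z + B + (Q₁, Q₂) and suppose (C - P)² ⊂ W. Then 0 ∈ W, which forces (Q₁, Q₂)
∈ H² + B and so W ⊂ H² + B. This closed subgroup contains (C - P)², and C lies in no proper coset,
so H² + B = A² (`eq_top_of_forall_kPair_mem`). Let K₁, K₂ be the projections of B to A; they are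
nonzero because H ≠ A. Since ψ kills both of them and has finite kernel N on H, K₁ × K₂ lies in the
finite union N² + B of translates of B, hence by irreducibility in B (`kPair_mem_of_sup_eq_top`). As
0 ∈ W, also B ⊂ W ⊂ Diff(C³): for all s ∈ K₁, t ∈ K₂ some c has c, c + s, c + t ∈ C.

This makes C - P a subgroup (`exists_subgroup_of_curve`). Either K₁ preserves C - P, which is then
the closure of K₁; or some C ∩ (C - s) is finite, one of its points c satisfies c + K₂ ⊂ C, and C -
P is the closure of K₂. So C is a coset, hence all of A, a contradiction.

The argument runs on k-points with the Zariski topology, where separate continuity of the group law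
suffices; `isAbelianSubvariety_of_subgroup` leads back to group schemes. -/

namespace FaltingsZhang

/-! ### Irreducible sets and separately continuous maps -/

section Irreducible

open Set TopologicalSpace

variable {X Y Z : Type*} [TopologicalSpace X] [TopologicalSpace Y] [TopologicalSpace Z]

/-- The image of a product of irreducible sets under a separately continuous map is irreducible. -/
lemma _root_.IsIrreducible.image2 {f : X → Y → Z} (hf : ∀ x, Continuous (f x))
    (hf' : ∀ y, Continuous fun x ↦ f x y) {s : Set X} {t : Set Y} (hs : IsIrreducible s)
    (ht : IsIrreducible t) : IsIrreducible (image2 f s t) := by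
  refine ⟨hs.1.image2 ht.1, isPreirreducible_iff_isClosed_union_isClosed.2 fun z₁ z₂ h₁ h₂ h ↦ ?_⟩
  have key (z : Set Z) (hz : IsClosed z) : IsClosed {x | ∀ y ∈ t, f x y ∈ z} := by
    simp only [ofPred_forall]
    exact isClosed_biInter fun y _ ↦ hz.preimage (hf' y)
  -- Each slice `f x '' t` is irreducible, so it lies in `z₁` or in `z₂`; this closed cover of `s`
  -- is what irreducibility of `s` is applied to.
  have hcov : s ⊆ {x | ∀ y ∈ t, f x y ∈ z₁} ∪ {x | ∀ y ∈ t, f x y ∈ z₂} := by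
    intro x hx
    have := isPreirreducible_iff_isClosed_union_isClosed.1 ht.2 _ _ (h₁.preimage (hf x))
      (h₂.preimage (hf x)) fun y hy ↦ h (mem_image2_of_mem hx hy)
    exact this.imp (fun h y hy ↦ h hy) (fun h y hy ↦ h hy)
  refine (isPreirreducible_iff_isClosed_union_isClosed.1 hs.2 _ _ (key _ h₁) (key _ h₂) hcov).imp
    ?_ ?_ <;>
  · rintro h' _ ⟨x, hx, y, hy, rfl⟩
    exact h' hx y hy

/-- An irreducible set covered by finitely many closed sets lies in one of them. -/
lemma _root_.IsIrreducible.exists_subset_of_finite {I : Type*} {s : Set X} (hs : IsIrreducible s)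
    {F : Set I} (hF : F.Finite) {z : I → Set X} (hz : ∀ i ∈ F, IsClosed (z i))
    (h : ∀ x ∈ s, ∃ i ∈ F, x ∈ z i) : ∃ i ∈ F, s ⊆ z i := by
  classical
  obtain ⟨_, hw, hs'⟩ := isIrreducible_iff_sUnion_isClosed.1 hs (hF.toFinset.image z)
    (by simpa using hz) (fun x hx ↦ by simpa using h x hx)
  simp only [Finset.mem_image, Finite.mem_toFinset] at hw
  obtain ⟨i, hi, rfl⟩ := hw
  exact ⟨i, hi, hs'⟩

lemma _root_.Topology.IsInducing.isIrreducible_image_iff {f : X → Y}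
    (hf : Topology.IsInducing f) {s : Set X} : IsIrreducible (f '' s) ↔ IsIrreducible s := by
  refine ⟨fun h ↦ ⟨h.1.of_image, ?_⟩, fun h ↦ h.image f hf.continuous.continuousOn⟩
  rw [isPreirreducible_iff_isClosed_union_isClosed]
  intro z₁ z₂ h₁ h₂ hz
  obtain ⟨w₁, hw₁, rfl⟩ := hf.isClosed_iff.1 h₁
  obtain ⟨w₂, hw₂, rfl⟩ := hf.isClosed_iff.1 h₂
  simpa [image_subset_iff] using
    isPreirreducible_iff_isClosed_union_isClosed.1 h.2 w₁ w₂ hw₁ hw₂ (by simpa using hz)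

end Irreducible

/-! ### Irreducible subgroups and curves in topologized commutative groups -/

section Group

open Set TopologicalSpace

variable {M : Type*} [CommGroup M] [TopologicalSpace M] [SeparatelyContinuousMul M]

lemma _root_.IsIrreducible.mul {s t : Set M} (hs : IsIrreducible s) (ht : IsIrreducible t) :
    IsIrreducible (s * t) :=
  hs.image2 (fun a ↦ continuous_const_mul a) (fun a ↦ continuous_mul_const a) ht

variable [ContinuousInv M]

/-- The identity component, as a subgroup. -/
def irreducibleComponentOfOne (M : Type*) [CommGroup M] [TopologicalSpace M]
    [SeparatelyContinuousMul M] [ContinuousInv M] : Subgroup M where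
  carrier := irreducibleComponent 1
  one_mem' := mem_irreducibleComponent
  mul_mem' {a b} ha hb := by
    -- The product of the component with itself is irreducible and contains the component, so by
    -- maximality the two are equal.
    rw [← eq_irreducibleComponent (x := (1 : M))
      (isIrreducible_irreducibleComponent.mul isIrreducible_irreducibleComponent).2
      fun x hx ↦ ⟨x, hx, 1, mem_irreducibleComponent, mul_one x⟩]
    exact mul_mem_mul ha hb
  inv_mem' {a} ha := by
    have hinv : IsIrreducible (irreducibleComponent (1 : M))⁻¹ := by
      rw [← image_inv_eq_inv]
      exact isIrreducible_irreducibleComponent.image _ continuous_inv.continuousOn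
    change a⁻¹ ∈ irreducibleComponent 1
    rw [← eq_irreducibleComponent (x := (1 : M))
      (isIrreducible_irreducibleComponent.mul hinv).2
      fun x hx ↦ ⟨x, hx, 1, by simpa using mem_irreducibleComponent, mul_one x⟩]
    exact ⟨1, mem_irreducibleComponent, a⁻¹, by simpa using ha, one_mul _⟩

/-- The component times `s` is irreducible and contains both factors; maximality of the component
does the rest. In particular only one irreducible component passes through the identity. -/
lemma subset_irreducibleComponentOfOne {s : Set M} (hs : IsIrreducible s) (h1 : (1 : M) ∈ s) :
    s ⊆ irreducibleComponentOfOne M := by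
  change s ⊆ irreducibleComponent 1
  rw [← eq_irreducibleComponent (x := (1 : M))
      (isIrreducible_irreducibleComponent.mul hs).2
      fun x hx ↦ ⟨x, hx, 1, h1, mul_one x⟩]
  exact fun x hx ↦ ⟨1, mem_irreducibleComponent, x, hx, one_mul x⟩

/-- Every closed subgroup contains an irreducible closed subgroup that contains all its irreducible
subsets through the identity. -/
lemma exists_irreducible_subgroup (G : Subgroup M) (hG : IsClosed (G : Set M)) :
    ∃ V : Subgroup M, IsClosed (V : Set M) ∧ IsIrreducible (V : Set M) ∧ V ≤ G ∧
      ∀ s : Set M, IsIrreducible s → 1 ∈ s → s ⊆ G → s ⊆ V := by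
  have : SeparatelyContinuousMul G := ⟨by
    intro a; exact ((continuous_const_mul (a : M)).comp continuous_subtype_val).subtype_mk _, by
    intro a; exact ((continuous_mul_const (a : M)).comp continuous_subtype_val).subtype_mk _⟩
  have : ContinuousInv G := ⟨(continuous_inv.comp continuous_subtype_val).subtype_mk _⟩
  refine ⟨(irreducibleComponentOfOne G).map G.subtype, ?_, ?_, ?_, fun s hs h1 hsG ↦ ?_⟩
  · rw [Subgroup.coe_map]
    exact hG.isClosedMap_subtype_val _ isClosed_irreducibleComponent
  · rw [Subgroup.coe_map]
    exact isIrreducible_irreducibleComponent.image _ continuous_subtype_val.continuousOn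
  · exact Subgroup.map_subtype_le _
  · have hs' : (fun x : G ↦ (x : M)) '' {x | (x : M) ∈ s} = s := by
      ext x
      simpa using fun h ↦ hsG h
    have hirr : IsIrreducible {x : G | (x : M) ∈ s} := by
      refine (Topology.IsInducing.isIrreducible_image_iff
        (f := fun x : G ↦ (x : M)) Topology.IsInducing.subtypeVal).1 ?_
      rwa [hs']
    rw [← hs', Subgroup.coe_map]
    exact image_mono (subset_irreducibleComponentOfOne hirr h1)

/-- The closure of a subgroup of a group with separately continuous multiplication. -/
def closureSubgroup (K : Subgroup M) : Subgroup M where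
  carrier := closure K
  one_mem' := subset_closure K.one_mem
  mul_mem' {a b} ha hb := by
    -- Without joint continuity the closure is taken in one factor at a time.
    have h1 (x : M) (hx : x ∈ K) (y : M) (hy : y ∈ closure (K : Set M)) :
        x * y ∈ closure (K : Set M) :=
      map_mem_closure (f := (x * ·)) (continuous_const_mul x) hy fun z hz ↦ K.mul_mem hx hz
    have := map_mem_closure (f := (· * b)) (t := closure (K : Set M)) (continuous_mul_const b) ha
      fun z hz ↦ h1 z hz b hb
    rwa [closure_closure] at this
  inv_mem' {a} ha := map_mem_closure (f := (·⁻¹)) continuous_inv ha fun _ hz ↦ K.inv_mem hz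

/-- If `S` is a curve through the identity, and `K₁`, `K₂` are nontrivial irreducible
subgroups such that for all `(s, t)` in `K₁ × K₂` there is `q` in `S` with `q s` and `q t` in `S`,
then `S` is a subgroup. -/
theorem exists_subgroup_of_curve [T1Space M] [NoetherianSpace M] {S : Set M} (hSc : IsClosed S)
    (h1 : 1 ∈ S)
    (hS : ∀ T : Set M, IsClosed T → IsIrreducible T → T.Nontrivial → T ⊆ S → T = S)
    (K₁ K₂ : Subgroup M) (hK₁ : IsIrreducible (K₁ : Set M)) (hK₂ : IsIrreducible (K₂ : Set M))
    (hn₁ : (K₁ : Set M).Nontrivial) (hn₂ : (K₂ : Set M).Nontrivial)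
    (h : ∀ s ∈ K₁, ∀ t ∈ K₂, ∃ q ∈ S, q * s ∈ S ∧ q * t ∈ S) :
    ∃ V : Subgroup M, (V : Set M) = S := by
  by_cases hst : ∀ s ∈ K₁, ∀ q ∈ S, q * s ∈ S
  · refine ⟨closureSubgroup K₁, hS _ isClosed_closure hK₁.closure (hn₁.mono subset_closure)
      (closure_minimal (fun s hs ↦ ?_) hSc)⟩
    simpa using hst s hs 1 h1
  · push Not at hst
    obtain ⟨s, hs, q₀, hq₀, hq₀s⟩ := hst
    -- `F` omits `q₀`, so it is a proper closed subset of the curve: an infinite irreducible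
    -- component of `F` would be all of `S`.
    set F : Set M := S ∩ (· * s) ⁻¹' S with hFdef
    have hFc : IsClosed F := hSc.inter (hSc.preimage (continuous_mul_const s))
    have hF : F.Finite := by
      obtain ⟨W, hWf, hWc, hWi, hW⟩ :=
        NoetherianSpace.exists_finite_set_isClosed_irreducible hFc
      rw [hW]
      refine hWf.sUnion fun T hT ↦ ?_
      by_contra hinf
      have hTF : T ⊆ F := hW ▸ subset_sUnion_of_mem hT
      have hTS := hS T (hWc T hT) (hWi T hT) (not_subsingleton_iff.1 fun h ↦ hinf h.finite)
        (hTF.trans inter_subset_left)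
      exact hq₀s (hTF (hTS ▸ hq₀)).2
    -- The finitely many closed sets `q⁻¹ S`, for `q` in `F`, cover the irreducible `K₂`, so a
    -- single `q` serves all `t`.
    obtain ⟨q, hq, hqK⟩ := hK₂.exists_subset_of_finite hF (z := fun q ↦ (q * ·) ⁻¹' S)
      (fun q _ ↦ hSc.preimage (continuous_const_mul q)) (fun t ht ↦ by
        obtain ⟨q, hq, hqs, hqt⟩ := h s hs t ht
        exact ⟨q, ⟨hq, hqs⟩, hqt⟩)
    have himg : (fun t ↦ q * t) '' closure (K₂ : Set M) = S := by
      refine hS _ ?_ (hK₂.closure.image _ (continuous_const_mul q).continuousOn)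
        ((hn₂.mono subset_closure).image (mul_right_injective q))
        (image_subset_iff.2 (closure_minimal hqK (hSc.preimage (continuous_const_mul q))))
      have : (fun t ↦ q * t) '' closure (K₂ : Set M) = (q⁻¹ * ·) ⁻¹' closure (K₂ : Set M) := by
        rw [image_mul_left]
      rw [this]
      exact isClosed_closure.preimage (continuous_const_mul _)
    have hqV : q ∈ closureSubgroup K₂ := by
      obtain ⟨t, ht, hqt⟩ := himg.ge h1
      rw [eq_inv_of_mul_eq_one_left hqt]
      exact (closureSubgroup K₂).inv_mem ht
    refine ⟨closureSubgroup K₂, ?_⟩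
    rw [← himg]
    ext t
    refine ⟨fun ht ↦ ⟨q⁻¹ * t, (closureSubgroup K₂).mul_mem (inv_mem hqV) ht, by simp⟩, ?_⟩
    rintro ⟨t, ht, rfl⟩
    exact (closureSubgroup K₂).mul_mem hqV ht

end Group

end FaltingsZhang

/-! ### The Zariski topology on k-points -/

namespace FaltingsZhang

variable {k : Type u} [Field k]

/-- The point of the underlying space of `X` at which a `k`-point is located. -/
noncomputable def toPoint {X : Over (Spec (.of k))} (P : KPoint X) : X.left :=
  P.left (IsLocalRing.closedPoint k)

/-- The Zariski topology on the set of `k`-points. -/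
noncomputable instance zariskiTopology (X : Over (Spec (.of k))) : TopologicalSpace (KPoint X) :=
  .induced toPoint inferInstance

lemma isInducing_toPoint (X : Over (Spec (.of k))) :
    Topology.IsInducing (toPoint : KPoint X → X.left) := ⟨rfl⟩

lemma toPoint_onPoints {X Y : Over (Spec (.of k))} (f : X ⟶ Y) (P : KPoint X) :
    toPoint (onPoints f P) = f.left (toPoint P) := rfl

lemma mem_kPoints {X : Over (Spec (.of k))} {V : Set X.left} {P : KPoint X} :
    P ∈ kPoints V ↔ toPoint P ∈ V := Iff.rfl

lemma continuous_onPoints {X Y : Over (Spec (.of k))} (f : X ⟶ Y) : Continuous (onPoints f) :=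
  (isInducing_toPoint Y).continuous_iff.2
    (f.left.continuous.comp (isInducing_toPoint X).continuous)

lemma isClosed_kPoints {X : Over (Spec (.of k))} {V : Set X.left} (hV : IsClosed V) :
    IsClosed (kPoints V) :=
  hV.preimage (isInducing_toPoint X).continuous

lemma kPoints_closure_image {X : Over (Spec (.of k))} (S : Set (KPoint X)) :
    kPoints (closure (toPoint '' S)) = closure S :=
  ((isInducing_toPoint X).closure_eq_preimage_closure_image S).symm

instance (X : Over (Spec (.of k))) [IsProper X.hom] (Y : Over (Spec (.of k)))
    [IsProper Y.hom] : IsProper (X ⊗ Y).hom := by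
  rw [Over.tensorObj_hom]
  infer_instance

/-- Supplies the reduced source needed to restrict a multiplication to a closed subscheme by a check
on k-points. -/
lemma isIntegral_tensorObj_left (X : Over (Spec (.of k))) [GeometricallyIntegral X.hom]
    (Y : Over (Spec (.of k))) [GeometricallyIntegral Y.hom] [LocallyOfFiniteType Y.hom] :
    IsIntegral (X ⊗ Y).left := by
  have : IsLocallyNoetherian Y.left :=
    LocallyOfFiniteType.isLocallyNoetherian (Y := Spec (.of k)) Y.hom
  have : IsIntegral Y.left :=
    GeometricallyIntegral.isIntegral_of_subsingleton (S := Spec (.of k)) Y.hom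
  exact inferInstanceAs (IsIntegral (pullback (Z := Spec (.of k)) X.hom Y.hom))

lemma noetherianSpace_left (X : Over (Spec (.of k))) [IsProper X.hom] :
    TopologicalSpace.NoetherianSpace X.left := by
  have : IsLocallyNoetherian X.left :=
    LocallyOfFiniteType.isLocallyNoetherian (Y := Spec (.of k)) X.hom
  have : CompactSpace X.left := QuasiCompact.compactSpace_of_compactSpace (Y := Spec (.of k)) X.hom
  have : IsNoetherian X.left := {}
  infer_instance

lemma jacobsonSpace_left (X : Over (Spec (.of k))) [LocallyOfFiniteType X.hom] :
    JacobsonSpace X.left := LocallyOfFiniteType.jacobsonSpace (Y := Spec (.of k)) X.hom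

section IsAlgClosed

variable [IsAlgClosed k] {X Y : Over (Spec (.of k))} [LocallyOfFiniteType X.hom]

lemma toPoint_injective : Function.Injective (toPoint : KPoint X → X.left) := fun P Q h ↦
  Over.OverMorphism.ext (ext_of_apply_closedPoint_eq X.hom (Over.w P) (Over.w Q) h)

lemma range_toPoint : Set.range (toPoint : KPoint X → X.left) = closedPoints X.left := by
  ext x
  refine ⟨?_, fun hx ↦ ?_⟩
  · rintro ⟨P, rfl⟩
    exact (pointEquivClosedPoint X.hom ⟨P.left, Over.w P⟩).2
  · exact ⟨Over.homMk (pointOfClosedPoint X.hom x hx) (pointOfClosedPoint_comp _ _ _),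
      pointOfClosedPoint_apply X.hom x hx _⟩

lemma image_toPoint_kPoints (V : Set X.left) : toPoint '' kPoints V = V ∩ closedPoints X.left := by
  rw [← range_toPoint]
  exact Set.image_preimage_eq_inter_range

instance : T1Space (KPoint X) := by
  refine ⟨fun P ↦ ?_⟩
  have : IsClosed {toPoint P} := by
    have := Set.mem_range_self (f := toPoint) P
    rwa [range_toPoint] at this
  convert this.preimage (isInducing_toPoint X).continuous using 1
  ext Q
  simp [toPoint_injective.eq_iff]

/-- A scheme locally of finite type over k is Jacobson, so closed points are dense in every closed
subset; as k is algebraically closed, they are the k-points. -/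
lemma closure_image_kPoints {V : Set X.left} (hV : IsClosed V) :
    closure (toPoint '' kPoints V) = V := by
  have := jacobsonSpace_left X
  rw [image_toPoint_kPoints, JacobsonSpace.closure_inter_closedPoints_eq_closure
    hV.isLocallyClosed, hV.closure_eq]

lemma isIrreducible_kPoints_iff {V : Set X.left} (hV : IsClosed V) :
    IsIrreducible (kPoints V) ↔ IsIrreducible V := by
  rw [← (isInducing_toPoint X).isIrreducible_image_iff, ← isIrreducible_iff_closure,
    closure_image_kPoints hV]

/-- A `k`-point in the set-theoretic image of a morphism lifts to a `k`-point. -/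
lemma range_onPoints [LocallyOfFiniteType Y.hom] (f : X ⟶ Y) :
    Set.range (onPoints f) = kPoints (Set.range f.left) := by
  ext Q
  refine ⟨?_, ?_⟩
  · rintro ⟨P, rfl⟩
    exact ⟨toPoint P, rfl⟩
  · rintro ⟨x, hx⟩
    have := jacobsonSpace_left X
    have hQ : IsClosed {toPoint Q} := by
      have := Set.mem_range_self (f := toPoint) Q
      rwa [range_toPoint] at this
    -- The fibre over a closed point is closed and nonempty, so it contains a closed point, that is,
    -- a k-point.
    obtain ⟨y, hy, hyc⟩ := nonempty_inter_closedPoints (Z := f.left ⁻¹' {toPoint Q}) ⟨x, hx⟩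
      (hQ.preimage f.left.continuous).isLocallyClosed
    rw [← range_toPoint] at hyc
    obtain ⟨P, rfl⟩ := hyc
    exact ⟨P, toPoint_injective hy⟩

lemma isClosed_range_onPoints {X Y : Over (Spec (.of k))} [IsProper X.hom] [IsProper Y.hom]
    (f : X ⟶ Y) :
    IsClosed (Set.range (onPoints f)) := by
  have : IsProper (f.left ≫ Y.hom) := by rw [Over.w]; infer_instance
  have : IsProper f.left := .of_comp _ Y.hom
  rw [range_onPoints]
  exact isClosed_kPoints f.left.isClosedMap.isClosed_range

/-- The image is closed by properness and contains the dense set of closed points. -/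
lemma surjective_left_of_onPoints {X Y : Over (Spec (.of k))} [IsProper X.hom] [IsProper Y.hom]
    (f : X ⟶ Y) (hf : Function.Surjective (onPoints f)) : Surjective f.left := by
  have : IsProper (f.left ≫ Y.hom) := by rw [Over.w]; infer_instance
  have : IsProper f.left := .of_comp _ Y.hom
  have hcl := f.left.isClosedMap.isClosed_range
  have h := closure_image_kPoints hcl
  rw [← range_onPoints, hf.range_eq, Set.image_univ, range_toPoint] at h
  have := jacobsonSpace_left Y
  rw [closure_closedPoints] at h
  exact ⟨Set.range_eq_univ.1 h.symm⟩

/-- A nontrivial irreducible closed set of `k`-points of a curve is the whole curve. -/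
lemma IsClosedCurve.eq_of_subset {C : Set X.left} (hC : IsClosedCurve C) {T : Set (KPoint X)}
    (hTc : IsClosed T) (hTi : IsIrreducible T) (hT : T.Nontrivial) (hTC : T ⊆ kPoints C) :
    T = kPoints C := by
  obtain ⟨P, hP, Q, hQ, hPQ⟩ := hT
  set T' : Set X.left := closure (toPoint '' T)
  have hTT' : kPoints T' = T := by rw [kPoints_closure_image, hTc.closure_eq]
  have hT'i : IsIrreducible T' :=
    (isIrreducible_kPoints_iff isClosed_closure).1 (by rwa [hTT'])
  have hT'C : T' ⊆ C := closure_minimal (Set.image_subset_iff.2 hTC) hC.isClosed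
  have hval : (Subtype.val : C → X.left) '' (Subtype.val ⁻¹' T') = T' := by
    ext x
    simpa using fun h ↦ hT'C h
  let t : TopologicalSpace.IrreducibleCloseds C :=
    { carrier := Subtype.val ⁻¹' T'
      isIrreducible' := by
        rw [← Topology.IsInducing.subtypeVal.isIrreducible_image_iff]
        exact hval.symm ▸ hT'i
      isClosed' := isClosed_closure.preimage continuous_subtype_val }
  let c : TopologicalSpace.IrreducibleCloseds C :=
    { carrier := Set.univ
      isIrreducible' := by
        rw [← Topology.IsInducing.subtypeVal.isIrreducible_image_iff]
        simpa using hC.isIrreducible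
      isClosed' := isClosed_univ }
  have hcl : IsClosed {toPoint P} := by
    have := Set.mem_range_self (f := toPoint) P
    rwa [range_toPoint] at this
  let p : TopologicalSpace.IrreducibleCloseds C :=
    { carrier := {⟨toPoint P, hTC hP⟩}
      isIrreducible' := isIrreducible_singleton
      isClosed' := by
        convert hcl.preimage (continuous_subtype_val (p := (· ∈ C))) using 1
        ext x
        simp [Subtype.ext_iff] }
  have hdim : Order.krullDim (TopologicalSpace.IrreducibleCloseds C) ≤ 1 := hC.dim_eq_one.le
  -- In dimension at most one every irreducible closed subset is minimal or maximal; minimality of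
  -- `t` would force `P = Q` through `p ≤ t`.
  rcases Order.krullDim_le_one_iff.1 hdim t with h | h
  · have hpt : p ≤ t := by
      rintro x rfl
      exact subset_closure ⟨P, hP, rfl⟩
    have : (⟨toPoint Q, hTC hQ⟩ : C) ∈ (p : Set C) := h hpt (subset_closure ⟨Q, hQ, rfl⟩)
    exact (hPQ (toPoint_injective (Subtype.ext_iff.1 this)).symm).elim
  · have htc : t ≤ c := fun x _ ↦ trivial
    refine hTC.antisymm fun R hR ↦ ?_
    rw [← hTT']
    exact h htc (x := ⟨toPoint R, hR⟩) trivial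

end IsAlgClosed

end FaltingsZhang

/-! ### Geometric integrality over an algebraically closed field -/

namespace FaltingsZhang

section Algebra

open scoped TensorProduct

/-- Weak Nullstellensatz: the `k`-points separate the elements of a reduced algebra of finite type
over an algebraically closed field `k`. -/
lemma exists_algHom_ne_zero {k R : Type*} [Field k] [IsAlgClosed k] [CommRing R] [Algebra k R]
    [Algebra.FiniteType k R] [_root_.IsReduced R] {r : R} (hr : r ≠ 0) :
    ∃ φ : R →ₐ[k] k, φ r ≠ 0 := by
  have : IsJacobsonRing R := isJacobsonRing_of_finiteType (A := k)
  have hjac : Ideal.jacobson (⊥ : Ideal R) = ⊥ :=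
    IsJacobsonRing.out inferInstance
      fun r ⟨n, hn⟩ ↦ _root_.IsReduced.eq_zero r ⟨n, by simpa using hn⟩
  -- So `r` avoids a maximal ideal, whose residue field is finite over k and hence equal to k.
  have : r ∉ Ideal.jacobson (⊥ : Ideal R) := by simpa [hjac] using hr
  simp only [Ideal.jacobson, Submodule.mem_sInf, not_forall] at this
  obtain ⟨m, ⟨-, hm⟩, hrm⟩ := this
  let _ : Field (R ⧸ m) := Ideal.Quotient.field m
  have : Algebra.FiniteType k (R ⧸ m) :=
    .of_surjective (Ideal.Quotient.mkₐ k m) Ideal.Quotient.mk_surjective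
  have : Module.Finite k (R ⧸ m) := finite_of_finite_type_of_isJacobsonRing k (R ⧸ m)
  let e : k ≃ₐ[k] R ⧸ m := AlgEquiv.ofBijective (Algebra.ofId k (R ⧸ m))
    (IsAlgClosed.algebraMap_bijective_of_isIntegral)
  refine ⟨e.symm.toAlgHom.comp (Ideal.Quotient.mkₐ k m), ?_⟩
  simpa [Ideal.Quotient.eq_zero_iff_mem] using hrm

/-- The tensor product of two domains over an algebraically closed field is a domain. -/
lemma isDomain_tensorProduct {k R L : Type*} [Field k] [IsAlgClosed k] [CommRing R] [Algebra k R]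
    [Algebra.FiniteType k R] [IsDomain R] [CommRing L] [IsDomain L] [Algebra k L] :
    IsDomain (R ⊗[k] L) := by
  have : Nontrivial (R ⊗[k] L) := by
    have h : Function.Injective (Algebra.TensorProduct.includeLeft : R →ₐ[k] R ⊗[k] L) :=
      Algebra.TensorProduct.includeLeft_injective (FaithfulSMul.algebraMap_injective k L)
    exact h.nontrivial
  have : NoZeroDivisors (R ⊗[k] L) := by
    refine ⟨fun {x y} hxy ↦ ?_⟩
    let b := Module.Free.chooseBasis k L
    let b' := Algebra.TensorProduct.basis R b
    by_contra! h
    obtain ⟨i, hi⟩ : ∃ i, b'.repr x i ≠ 0 := by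
      by_contra! h0
      exact h.1 (b'.repr.map_eq_zero_iff.1 (Finsupp.ext h0))
    obtain ⟨j, hj⟩ : ∃ j, b'.repr y j ≠ 0 := by
      by_contra! h0
      exact h.2 (b'.repr.map_eq_zero_iff.1 (Finsupp.ext h0))
    -- Specializing the coefficients at a k-point where both chosen ones survive sends `x` and `y`
    -- to nonzero elements of the domain `L`.
    obtain ⟨φ, hφ⟩ := exists_algHom_ne_zero (k := k) (mul_ne_zero hi hj)
    let Φ : R ⊗[k] L →ₐ[k] L :=
      Algebra.TensorProduct.lift ((Algebra.ofId k L).comp φ) (AlgHom.id k L) fun _ _ ↦ .all _ _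
    have key (z : R ⊗[k] L) (l) : b.repr (Φ z) l = φ (b'.repr z l) := by
      induction z with
      | zero => simp
      | add z w hz hw => simp [hz, hw]
      | tmul r a =>
        have : Φ (r ⊗ₜ a) = φ r • a := by simp [Φ, Algebra.ofId_apply, Algebra.smul_def]
        simp [this, b']
    have h0 : Φ x * Φ y = 0 := by rw [← map_mul, hxy, map_zero]
    rcases mul_eq_zero.1 h0 with h0 | h0
    · exact hφ (by rw [map_mul, ← key, h0]; simp)
    · exact hφ (by rw [map_mul, ← key y, h0]; simp)
  exact NoZeroDivisors.to_isDomain _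

end Algebra

/-- An integral scheme locally of finite type over an algebraically closed field is geometrically
integral. -/
lemma geometricallyIntegral_of_isIntegral {k : Type u} [Field k] [IsAlgClosed k] {X : Scheme.{u}}
    (f : X ⟶ Spec (.of k)) [LocallyOfFiniteType f] [IsIntegral X] : GeometricallyIntegral f := by
  rw [geometricallyIntegral_iff, geometrically_iff_of_commRing]
  intro K _ _ Y p q hpq
  -- Over a nonempty affine open `Spec R` of `X`, the base change is the spectrum of the domain `R ⊗
  -- K`.
  have key {R : CommRingCat.{u}} (j : Spec R ⟶ X) [IsOpenImmersion j] [Nonempty (Spec R)] :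
      IsIntegral (pullback p j) := by
    have hR : IsIntegral (Spec R) := isIntegral_of_isOpenImmersion j
    have : IsDomain R := (affine_isIntegral_iff R).1 hR
    obtain ⟨φ, hφ⟩ := Spec.map_surjective (j ≫ f)
    have hft : LocallyOfFiniteType (Spec.map φ) := by rw [hφ]; infer_instance
    have hft' : RingHom.FiniteType φ.hom := HasRingHomProperty.Spec_iff.mp hft
    algebraize [φ.hom]
    have h₁ : IsPullback (pullback.snd p j) (pullback.fst p j ≫ q) (j ≫ f)
        (Spec.map (CommRingCat.ofHom (algebraMap k K))) :=
      (IsPullback.of_hasPullback p j).flip.paste_vert hpq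
    have h₂ := isPullback_SpecMap_of_isPushout _ _ _ _ (CommRingCat.isPushout_tensorProduct k R K)
    have hdom : IsDomain (TensorProduct k R K) := isDomain_tensorProduct
    have h₃ : IsIntegral (Spec (.of (TensorProduct k R K))) := (affine_isIntegral_iff _).2 hdom
    have hφ' : CommRingCat.ofHom (algebraMap k R) = φ := rfl
    rw [hφ', hφ] at h₂
    let e := h₁.isoIsPullback _ _ h₂
    have : Nonempty ↥(pullback p j) := Nonempty.map e.inv inferInstance
    exact isIntegral_of_isOpenImmersion e.hom
  rw [isIntegral_iff_irreducibleSpace_and_isReduced]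
  constructor
  -- As `p` is open, the preimage of a dense affine open is dense; it is irreducible by `key`, hence
  -- so is its closure `Y`.
  · have hp : UniversallyOpen p := MorphismProperty.of_isPullback hpq.flip inferInstance
    obtain ⟨x⟩ : Nonempty X := inferInstance
    obtain ⟨y, -⟩ := X.affineOpenCover.covers x
    have : Nonempty (Spec (X.affineOpenCover.X (X.affineOpenCover.idx x))) := ⟨y⟩
    let j := X.affineOpenCover.f (X.affineOpenCover.idx x)
    have := key j
    have hirr : IsIrreducible (Set.range (pullback.fst p j)) := by
      rw [← Set.image_univ]
      exact (IrreducibleSpace.isIrreducible_univ _).image _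
        (pullback.fst p j).continuous.continuousOn
    have hdense : Dense (Set.range (pullback.fst p j)) := by
      rw [Scheme.Pullback.range_fst]
      exact ((j.isOpenEmbedding.isOpen_range).dense ⟨_, y, rfl⟩).preimage p.isOpenMap
    have := hirr.closure
    rw [hdense.closure_eq] at this
    exact (irreducibleSpace_def _).2 this
  · have hred (a : X.affineOpenCover.I₀) : IsReduced (pullback p (X.affineOpenCover.f a)) := by
      rcases isEmpty_or_nonempty (Spec (X.affineOpenCover.X a)) with h | h
      · have hW : IsEmpty ↥(pullback p (X.affineOpenCover.f a)) :=
          Function.isEmpty (pullback.snd p (X.affineOpenCover.f a))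
        have (x : ↥(pullback p (X.affineOpenCover.f a))) :
          _root_.IsReduced ((pullback p (X.affineOpenCover.f a)).presheaf.stalk x) := hW.elim x
        exact isReduced_of_isReduced_stalk _
      · have := key (X.affineOpenCover.f a)
        infer_instance
    have : ∀ a, IsReduced ((X.affineOpenCover.openCover.pullback₁ p).X a) := hred
    exact IsReduced.of_openCover _ (X.affineOpenCover.openCover.pullback₁ p)

end FaltingsZhang

/-! ### From irreducible closed subgroups to abelian subvarieties -/

namespace FaltingsZhang

/-- A subobject of a group object that is closed under the group operations is a group object. -/
@[reducible]
def grpObjOfMono {𝒞 : Type*} [Category 𝒞] [CartesianMonoidalCategory 𝒞] {G A : 𝒞} [GrpObj A]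
    (j : G ⟶ A) [Mono j] (e : 𝟙_ 𝒞 ⟶ G) (he : e ≫ j = η) (m : G ⊗ G ⟶ G)
    (hm : m ≫ j = (j ⊗ₘ j) ≫ μ) (v : G ⟶ G) (hv : v ≫ j = j ≫ ι) : GrpObj G where
  one := e
  mul := m
  inv := v
  one_mul := by
    rw [← cancel_mono j, Category.assoc, hm, ← tensorHom_id, tensorHom_comp_tensorHom_assoc, he,
      Category.id_comp, tensorHom_def', Category.assoc, MonObj.one_mul, leftUnitor_naturality]
  mul_one := by
    rw [← cancel_mono j, Category.assoc, hm, ← id_tensorHom, tensorHom_comp_tensorHom_assoc, he,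
      Category.id_comp, MonoidalCategory.tensorHom_def, Category.assoc, MonObj.mul_one, rightUnitor_naturality]
  mul_assoc := by
    have h₁ : (m ▷ G) ≫ (j ⊗ₘ j) = ((j ⊗ₘ j) ⊗ₘ j) ≫ (μ ▷ A) := by
      rw [← tensorHom_id, tensorHom_comp_tensorHom, hm, ← tensorHom_id, tensorHom_comp_tensorHom,
        Category.id_comp, Category.comp_id]
    have h₂ : (G ◁ m) ≫ (j ⊗ₘ j) = (j ⊗ₘ (j ⊗ₘ j)) ≫ (A ◁ μ) := by
      rw [← id_tensorHom, tensorHom_comp_tensorHom, hm, ← id_tensorHom, tensorHom_comp_tensorHom,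
        Category.id_comp, Category.comp_id]
    rw [← cancel_mono j]
    simp only [Category.assoc, hm]
    rw [reassoc_of% h₁, reassoc_of% h₂, MonObj.mul_assoc, associator_naturality_assoc]
  left_inv := by
    have h : lift (j ≫ ι) j = j ≫ lift ι (𝟙 A) := by simp
    rw [← cancel_mono j, Category.assoc, hm, lift_map_assoc, hv, Category.id_comp,
      Category.assoc, he, h, Category.assoc, GrpObj.left_inv, comp_toUnit_assoc]
  right_inv := by
    have h : lift j (j ≫ ι) = j ≫ lift (𝟙 A) ι := by simp
    rw [← cancel_mono j, Category.assoc, hm, lift_map_assoc, hv, Category.id_comp,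
      Category.assoc, he, h, Category.assoc, GrpObj.right_inv, comp_toUnit_assoc]

/-- The reduced closed subscheme structure on an irreducible closed subset. -/
lemma exists_isIntegral_isClosedImmersion {X : Scheme.{u}} [IsLocallyNoetherian X] {V : Set X}
    (hV : IsClosed V) (hVi : IsIrreducible V) :
    ∃ (Y : Scheme.{u}) (j : Y ⟶ X), IsIntegral Y ∧ IsClosedImmersion j ∧ Set.range j = V := by
  obtain ⟨x, hx⟩ := QuasiSober.sober hVi hV
  -- The subscheme is the scheme-theoretic image of the generic point; its sections over affine
  -- opens inject into those of the spectrum of a field, so it is reduced.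
  let f := X.fromSpecResidueField x
  have : QuasiCompact f := inferInstance
  have hrange : Set.range f.imageι = V := by
    rw [Scheme.IdealSheafData.range_subschemeι, Scheme.Hom.support_ker]
    simp only [f, Scheme.range_fromSpecResidueField]
    exact hx
  have hdom : IsSchemeTheoreticallyDominant f.toImage := by
    rw [isSchemeTheoreticallyDominant_iff]
    refine Scheme.IdealSheafData.ext_of_iSup_eq_top
      (fun U : X.affineOpens ↦ ⟨f.imageι ⁻¹ᵁ U.1, U.2.preimage f.imageι⟩) ?_ fun U ↦ ?_
    · have := iSup_affineOpens_eq_top X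
      simpa using congr(f.imageι ⁻¹ᵁ $this)
    · rw [Scheme.Hom.ker_apply, Scheme.IdealSheafData.ideal_bot, Pi.bot_apply,
        ← RingHom.injective_iff_ker_eq_bot]
      exact f.toImage_app_injective U
  have hred : IsReduced f.image := IsSchemeTheoreticallyDominant.isReduced f.toImage
  have hirr : IrreducibleSpace f.image := by
    refine (irreducibleSpace_def _).2
      (f.imageι.isEmbedding.isInducing.isIrreducible_image_iff.1 ?_)
    change IsIrreducible (f.imageι '' Set.univ)
    rwa [Set.image_univ, hrange]
  exact ⟨f.image, f.imageι, isIntegral_of_irreducibleSpace_of_isReduced _, inferInstance, hrange⟩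

variable {k : Type u} [Field k] [IsAlgClosed k]

/-- A morphism from a reduced scheme that maps `k`-points into a closed subscheme factors through
this subscheme. -/
lemma exists_comp_eq_of_forall_mem {T Y A : Over (Spec (.of k))} [LocallyOfFiniteType T.hom]
    [IsReduced T.left] (f : T ⟶ A) (j : Y ⟶ A) [IsClosedImmersion j.left]
    (h : ∀ P : KPoint T, toPoint (onPoints f P) ∈ Set.range j.left) : ∃ g : T ⟶ Y, g ≫ j = f := by
  have := jacobsonSpace_left T
  have hcl : IsClosed (f.left ⁻¹' Set.range j.left) :=
    j.left.isClosedEmbedding.isClosed_range.preimage f.left.continuous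
  have hrange : f.left ⁻¹' Set.range j.left = Set.univ := by
    refine Set.univ_subset_iff.1 ?_
    rw [← closure_closedPoints, ← range_toPoint]
    refine closure_minimal ?_ hcl
    rintro _ ⟨P, rfl⟩
    exact h P
  have : Surjective (pullback.fst f.left j.left) :=
    ⟨Set.range_eq_univ.1 (by rw [Scheme.Pullback.range_fst]; exact hrange)⟩
  -- A surjective closed immersion into a reduced scheme is an isomorphism.
  have : IsIso (pullback.fst f.left j.left) :=
    isIso_of_isClosedImmersion_of_surjective _
  let g : T.left ⟶ Y.left := inv (pullback.fst f.left j.left) ≫ pullback.snd f.left j.left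
  have hg : g ≫ j.left = f.left := by
    simp only [g, Category.assoc, ← pullback.condition, IsIso.inv_hom_id_assoc]
  refine ⟨Over.homMk g ?_, Over.OverMorphism.ext hg⟩
  rw [← Over.w j, reassoc_of% hg, Over.w]

/-- An irreducible closed subgroup of an abelian variety is an abelian subvariety. -/
theorem isAbelianSubvariety_of_subgroup {A : Over (Spec (.of k))} [GrpObj A] [IsProper A.hom]
    {V : Set A.left} (hV : IsClosed V) (hVi : IsIrreducible V) {S : Subgroup (KPoint A)}
    (hS : kPoints V = S) : IsAbelianSubvariety (S : Set (KPoint A)) := by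
  have : IsLocallyNoetherian A.left :=
    LocallyOfFiniteType.isLocallyNoetherian (Y := Spec (.of k)) A.hom
  obtain ⟨Y, j', hY, hj', hj'r⟩ := exists_isIntegral_isClosedImmersion hV hVi
  let G : Over (Spec (.of k)) := Over.mk (j' ≫ A.hom)
  let j : G ⟶ A := Over.homMk j'
  have hj : IsClosedImmersion j.left := hj'
  have hjr : Set.range j.left = V := hj'r
  have hjmono : Mono j := Over.mono_of_mono_left j
  have hGp : IsProper G.hom := inferInstanceAs (IsProper (j' ≫ A.hom))
  have hGi : IsIntegral G.left := hY
  have hGg : GeometricallyIntegral G.hom := geometricallyIntegral_of_isIntegral (X := G.left) G.hom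
  have hGG : IsIntegral (G ⊗ G).left := isIntegral_tensorObj_left G G
  have hjS (P : KPoint G) : onPoints j P ∈ S := by
    rw [← SetLike.mem_coe, ← hS, mem_kPoints, toPoint_onPoints, ← hjr]
    exact ⟨_, rfl⟩
  have hSr {P : KPoint A} (hP : P ∈ S) : toPoint P ∈ Set.range j.left := by
    rwa [hjr, ← mem_kPoints, hS]
  have h1 : IsIntegral (𝟙_ (Over (Spec (.of k)))).left :=
    inferInstanceAs (IsIntegral (Spec (.of k)))
  have h1' : LocallyOfFiniteType (𝟙_ (Over (Spec (.of k)))).hom :=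
    inferInstanceAs (LocallyOfFiniteType (𝟙 (Spec (.of k))))
  obtain ⟨e, he⟩ := exists_comp_eq_of_forall_mem η[A] j fun P ↦ hSr <| by
    convert S.one_mem
    rw [Hom.one_def, onPoints]
    congr 1
    exact toUnit_unique _ _
  obtain ⟨m, hm⟩ := exists_comp_eq_of_forall_mem ((j ⊗ₘ j) ≫ μ) j fun P ↦ hSr <| by
    convert S.mul_mem (hjS (onPoints (fst G G) P)) (hjS (onPoints (snd G G) P))
    simp only [Hom.mul_def, onPoints, ← Category.assoc]
    congr 1
    ext1 <;> simp
  obtain ⟨v, hv⟩ := exists_comp_eq_of_forall_mem (j ≫ ι) j fun P ↦ hSr <| by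
    convert S.inv_mem (hjS P)
    simp [Hom.inv_def, onPoints]
  let : GrpObj G := grpObjOfMono j e he m hm v hv
  refine ⟨G, inferInstance, ⟨hGp, hGg⟩, j, ⟨he, hm⟩, hj, ?_⟩
  rw [range_onPoints, hjr, hS]

end FaltingsZhang

/-! ### The group of k-points -/

namespace FaltingsZhang

section KPoint

variable {k : Type u} [Field k]

/-- A homomorphism of group schemes induces a group homomorphism on `k`-points. -/
noncomputable def onPointsHom {X Y : Over (Spec (.of k))} [GrpObj X] [GrpObj Y] (f : X ⟶ Y)
    [IsMonHom f] : KPoint X →* KPoint Y where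
  toFun := onPoints f
  map_one' := MonObj.one_comp f
  map_mul' P Q := MonObj.mul_comp P Q f

lemma onPointsHom_apply {X Y : Over (Spec (.of k))} [GrpObj X] [GrpObj Y] (f : X ⟶ Y)
    [IsMonHom f] (P : KPoint X) : onPointsHom f P = onPoints f P := rfl

/-- Translations are morphisms of schemes. Joint continuity fails in general, because the Zariski
topology on a product is finer than the product topology. -/
instance (X : Over (Spec (.of k))) [GrpObj X] : SeparatelyContinuousMul (KPoint X) where
  continuous_const_mul {a} := by
    have h : (a * ·) = onPoints ((toUnit X ≫ a) * 𝟙 X) := by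
      funext P
      rw [onPoints, MonObj.comp_mul, Category.comp_id, ← Category.assoc,
        toUnit_unique (P ≫ toUnit X) (𝟙 _), Category.id_comp]
    rw [h]
    exact continuous_onPoints _
  continuous_mul_const {a} := by
    have h : (· * a) = onPoints (𝟙 X * (toUnit X ≫ a)) := by
      funext P
      rw [onPoints, MonObj.comp_mul, Category.comp_id, ← Category.assoc,
        toUnit_unique (P ≫ toUnit X) (𝟙 _), Category.id_comp]
    rw [h]
    exact continuous_onPoints _

instance (X : Over (Spec (.of k))) [GrpObj X] : ContinuousInv (KPoint X) where
  continuous_inv := continuous_onPoints (X := X) ι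

lemma onPoints_fst_kPair {X Y : Over (Spec (.of k))} (P : KPoint X) (Q : KPoint Y) :
    onPoints (fst X Y) (kPair P Q) = P := lift_fst P Q

lemma onPoints_snd_kPair {X Y : Over (Spec (.of k))} (P : KPoint X) (Q : KPoint Y) :
    onPoints (snd X Y) (kPair P Q) = Q := lift_snd P Q

lemma kPoint_tensor_ext {X Y : Over (Spec (.of k))} {P Q : KPoint (X ⊗ Y)}
    (h₁ : onPoints (fst X Y) P = onPoints (fst X Y) Q)
    (h₂ : onPoints (snd X Y) P = onPoints (snd X Y) Q) : P = Q :=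
  CartesianMonoidalCategory.hom_ext _ _ h₁ h₂

lemma onPoints_fst_tensorHom {X Y X' Y' : Over (Spec (.of k))} (f : X ⟶ X') (g : Y ⟶ Y')
    (P : KPoint (X ⊗ Y)) :
    onPoints (fst X' Y') (onPoints (f ⊗ₘ g) P) = onPoints f (onPoints (fst X Y) P) := by
  simp [onPoints]

lemma onPoints_snd_tensorHom {X Y X' Y' : Over (Spec (.of k))} (f : X ⟶ X') (g : Y ⟶ Y')
    (P : KPoint (X ⊗ Y)) :
    onPoints (snd X' Y') (onPoints (f ⊗ₘ g) P) = onPoints g (onPoints (snd X Y) P) := by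
  simp [onPoints]

lemma kPair_mul {X Y : Over (Spec (.of k))} [GrpObj X] [GrpObj Y] (P P' : KPoint X)
    (Q Q' : KPoint Y) : kPair P Q * kPair P' Q' = kPair (P * P') (Q * Q') := by
  refine kPoint_tensor_ext ?_ ?_
  · rw [← onPointsHom_apply, map_mul]
    simp only [onPointsHom_apply, onPoints_fst_kPair]
  · rw [← onPointsHom_apply, map_mul]
    simp only [onPointsHom_apply, onPoints_snd_kPair]

lemma kPair_one_one (X Y : Over (Spec (.of k))) [GrpObj X] [GrpObj Y] :
    kPair (1 : KPoint X) (1 : KPoint Y) = 1 := by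
  have h := kPair_mul (1 : KPoint X) 1 (1 : KPoint Y) 1
  rw [_root_.mul_one, _root_.mul_one] at h
  exact mul_eq_left.1 h

lemma continuous_kPair_left {X Y : Over (Spec (.of k))} (Q : KPoint Y) :
    Continuous fun P : KPoint X ↦ kPair P Q := by
  have h : (fun P : KPoint X ↦ kPair P Q) = onPoints (lift (𝟙 X) (toUnit X ≫ Q)) := by
    funext P
    rw [onPoints, comp_lift, Category.comp_id, ← Category.assoc,
        toUnit_unique (P ≫ toUnit X) (𝟙 _), Category.id_comp, kPair]
  rw [h]
  exact continuous_onPoints _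

lemma continuous_kPair_right {X Y : Over (Spec (.of k))} (P : KPoint X) :
    Continuous fun Q : KPoint Y ↦ kPair P Q := by
  have h : (fun Q : KPoint Y ↦ kPair P Q) = onPoints (lift (toUnit Y ≫ P) (𝟙 Y)) := by
    funext Q
    rw [onPoints, comp_lift, Category.comp_id, ← Category.assoc,
        toUnit_unique (Q ≫ toUnit Y) (𝟙 _), Category.id_comp, kPair]
  rw [h]
  exact continuous_onPoints _

/-- The kernel of an isogeny has finitely many `k`-points. -/
lemma IsIsogeny.finite_ker [IsAlgClosed k] {G H : Over (Spec (.of k))} [GrpObj G] [GrpObj H]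
    [LocallyOfFiniteType G.hom] {f : G ⟶ H} (hf : IsIsogeny f) :
    {P : KPoint G | onPoints f P = 1}.Finite := by
  have := hf.isFinite_ker
  have hfin : (Set.range (pullback.fst f.left η[H].left)).Finite := by
    rw [← Set.image_univ]
    refine Set.Finite.image _ ?_
    convert! (pullback.snd f.left η[H].left).finite_preimage_singleton (IsLocalRing.closedPoint k)
    ext x
    simp only [Set.mem_univ, true_iff]
    exact Subsingleton.elim (α := Spec (.of k)) _ _
  refine Set.Finite.of_finite_image (f := toPoint) (hfin.subset ?_) toPoint_injective.injOn
  rintro _ ⟨P, hP, rfl⟩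
  rw [Scheme.Pullback.range_fst]
  change f.left (toPoint P) ∈ Set.range η[H].left
  rw [← toPoint_onPoints, (hP : onPoints f P = 1), Hom.one_def]
  exact ⟨(toUnit (𝟙_ (Over (Spec (.of k))))).left (IsLocalRing.closedPoint k), rfl⟩

end KPoint

variable {k : Type u} [Field k] [IsAlgClosed k]

lemma isIrreducible_univ_kPoint (G : Over (Spec (.of k))) [GeometricallyIntegral G.hom]
    [LocallyOfFiniteType G.hom] : IsIrreducible (Set.univ : Set (KPoint G)) := by
  have : IsIntegral G.left :=
    GeometricallyIntegral.isIntegral_of_subsingleton (S := Spec (.of k)) G.hom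
  exact (isIrreducible_kPoints_iff isClosed_univ).2 (IrreducibleSpace.isIrreducible_univ _)

/-- If the translate of a closed subgroup contains a curve that lies in no proper coset, then
this subgroup is everything. -/
lemma eq_top_of_curve_subset {A : Over (Spec (.of k))} [GrpObj A] [IsProper A.hom]
    [IsCommMonObj A] {C : Set A.left} (hC : IsClosedCurve C)
    (hcoset : ∀ S : Set (KPoint A), IsProperCoset S → ¬ kPoints C ⊆ S) {P : KPoint A}
    (hP : P ∈ kPoints C) (G : Subgroup (KPoint A)) (hG : IsClosed (G : Set (KPoint A)))
    (hCG : ∀ x, x * P ∈ kPoints C → x ∈ G) : G = ⊤ := by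
  obtain ⟨V, hVc, hVi, hVG, hV⟩ := exists_irreducible_subgroup G hG
  have hirr : IsIrreducible ((· * P⁻¹) '' kPoints C) :=
    ((isIrreducible_kPoints_iff hC.isClosed).2 hC.isIrreducible).image _
      (continuous_mul_const _).continuousOn
  -- `C - P` is irreducible and contains the identity, so it lies in the irreducible part `V` of
  -- `G`; then `V + P` is a coset containing `C`.
  have hCV := hV _ hirr ⟨P, hP, mul_inv_cancel P⟩ (by
    rintro _ ⟨x, hx, rfl⟩
    exact hCG _ (by simpa using hx))
  have hVk : kPoints (closure (toPoint '' (V : Set (KPoint A)))) = V := by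
    rw [kPoints_closure_image, hVc.closure_eq]
  have hVab : IsAbelianSubvariety (V : Set (KPoint A)) :=
    isAbelianSubvariety_of_subgroup isClosed_closure
      ((isIrreducible_kPoints_iff isClosed_closure).1 (by rwa [hVk])) hVk
  have huniv : (V : Set (KPoint A)) * {P} = Set.univ := by
    by_contra hne
    exact hcoset _ ⟨⟨V, P, hVab, rfl⟩, hne⟩ fun x hx ↦
      ⟨x * P⁻¹, hCV ⟨x, hx, rfl⟩, P, rfl, by simp⟩
  refine eq_top_iff.2 fun x _ ↦ hVG ?_
  obtain ⟨y, hy, z, hz, hyz⟩ := huniv.ge (Set.mem_univ (x * P))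
  obtain rfl : z = P := hz
  rwa [← mul_right_cancel hyz]

end FaltingsZhang

/-! ### Splitting B into its two projections -/

namespace FaltingsZhang
variable {k : Type u} [Field k] [IsAlgClosed k]

/-- If `H² + B = A²`, where `B` lies in the kernel of `ψ × ψ` and `ψ` has finite kernel on `H`,
then `B` contains the product of its two projections to `A`. -/
lemma kPair_mem_of_sup_eq_top {A H G : Over (Spec (.of k))} [GrpObj A] [GrpObj H] [GrpObj G]
    [IsProper A.hom] [IsProper H.hom] [IsAbelianVariety G] [IsCommMonObj A] {i : H ⟶ A}
    [IsMonHom i] {ψ : A ⟶ H} [IsMonHom ψ] (hψ : IsIsogeny (i ≫ ψ)) {j : G ⟶ A ⊗ A} [IsMonHom j]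
    (hj : ∀ b, onPoints (ψ ⊗ₘ ψ) (onPoints j b) = 1)
    (hE : (onPointsHom (i ⊗ₘ i)).range ⊔ (onPointsHom j).range = ⊤) (b₁ b₂ : KPoint G) :
    kPair (onPoints (fst A A) (onPoints j b₁)) (onPoints (snd A A) (onPoints j b₂)) ∈
      (onPointsHom j).range := by
  have := IsAbelianVariety.isProper (A := G)
  have := IsAbelianVariety.geometricallyIntegral (A := G)
  set B := (onPointsHom j).range
  let N : Set (KPoint H) := {P | onPoints (i ≫ ψ) P = 1}
  have hN : N.Finite := hψ.finite_ker
  have hψ₁ (b) : onPoints ψ (onPoints (fst A A) (onPoints j b)) = 1 := by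
    rw [← onPoints_fst_tensorHom (g := ψ), hj]
    exact map_one (onPointsHom (fst H H))
  have hψ₂ (b) : onPoints ψ (onPoints (snd A A) (onPoints j b)) = 1 := by
    rw [← onPoints_snd_tensorHom (f := ψ), hj]
    exact map_one (onPointsHom (snd H H))
  let f₁ : KPoint G → KPoint A := fun b ↦ onPoints (fst A A) (onPoints j b)
  let f₂ : KPoint G → KPoint A := fun b ↦ onPoints (snd A A) (onPoints j b)
  have hf₁ : IsIrreducible (f₁ '' Set.univ) := (isIrreducible_univ_kPoint G).image f₁
    ((continuous_onPoints (fst A A)).comp (continuous_onPoints j)).continuousOn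
  have hf₂ : IsIrreducible (f₂ '' Set.univ) := (isIrreducible_univ_kPoint G).image f₂
    ((continuous_onPoints (snd A A)).comp (continuous_onPoints j)).continuousOn
  have hirr : IsIrreducible (Set.image2 kPair (f₁ '' Set.univ) (f₂ '' Set.univ)) :=
    hf₁.image2 continuous_kPair_right continuous_kPair_left hf₂
  have hBc : IsClosed (B : Set (KPoint (A ⊗ A))) := isClosed_range_onPoints j
  -- Writing a point of the product as h + b and applying ψ × ψ, which kills both the point and b,
  -- puts the coordinates of h in the finite set `N`.
  obtain ⟨n, -, hn⟩ := hirr.exists_subset_of_finite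
    (F := Set.image2 (fun P Q ↦ kPair (onPoints i P) (onPoints i Q)) N N) (hN.image2 _ hN)
    (z := fun n ↦ (n⁻¹ * ·) ⁻¹' (B : Set (KPoint (A ⊗ A))))
    (fun n _ ↦ hBc.preimage (continuous_const_mul _)) (by
      rintro _ ⟨_, ⟨c₁, -, rfl⟩, _, ⟨c₂, -, rfl⟩, rfl⟩
      obtain ⟨_, ⟨h, rfl⟩, b, hb, hhb⟩ :=
        Subgroup.mem_sup.1 (hE.ge (Subgroup.mem_top (kPair (f₁ c₁) (f₂ c₂))))
      obtain ⟨b, rfl⟩ := hb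
      refine ⟨onPoints (i ⊗ₘ i) h, ⟨onPoints (fst H H) h, ?_, onPoints (snd H H) h, ?_, ?_⟩, ?_⟩
      · have h₁ := congr(onPointsHom ψ (onPointsHom (fst A A) $hhb))
        simp only [map_mul, onPointsHom_apply, onPoints_fst_kPair, onPoints_fst_tensorHom, hψ₁,
          _root_.mul_one, f₁] at h₁
        simpa [N, onPoints] using h₁
      · have h₂ := congr(onPointsHom ψ (onPointsHom (snd A A) $hhb))
        simp only [map_mul, onPointsHom_apply, onPoints_snd_kPair, onPoints_snd_tensorHom, hψ₂,
          _root_.mul_one, f₂] at h₂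
        simpa [N, onPoints] using h₂
      · refine kPoint_tensor_ext ?_ ?_
        · rw [onPoints_fst_kPair, onPoints_fst_tensorHom]
        · rw [onPoints_snd_kPair, onPoints_snd_tensorHom]
      · rw [Set.mem_preimage, ← hhb, onPointsHom_apply, inv_mul_cancel_left]
        exact ⟨b, rfl⟩)
  -- The product contains the identity, so the translate of `B` containing it is `B` itself.
  have h1 : n⁻¹ ∈ B := by
    have h := hn ⟨_, ⟨1, trivial, rfl⟩, _, ⟨1, trivial, rfl⟩, rfl⟩
    have h₁ : f₁ 1 = 1 := by
      simp only [f₁, ← onPointsHom_apply, map_one]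
    have h₂ : f₂ 1 = 1 := by
      simp only [f₂, ← onPointsHom_apply, map_one]
    simpa [h₁, h₂, kPair_one_one] using h
  exact (B.mul_mem_cancel_left h1).1 (hn ⟨_, ⟨b₁, trivial, rfl⟩, _, ⟨b₂, trivial, rfl⟩, rfl⟩)

end FaltingsZhang

/-! ### The difference morphism and the conclusion -/

namespace FaltingsZhang

lemma onPoints_Diff {k : Type u} [Field k] (A : Over (Spec (.of k))) [GrpObj A] (P₀ P₁ P₂ : KPoint A) :
    onPoints (Diff A) (kPair P₀ (kPair P₁ P₂)) = kPair (P₁ / P₀) (P₂ / P₀) := by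
  simp [onPoints, kPair, Diff, comp_lift, GrpObj.comp_div]

lemma exists_mul_mem_of_mem_diffCube {k : Type u} [Field k] {A : Over (Spec (.of k))} [GrpObj A]
    {C : Set A.left} {s t : KPoint A} (h : kPair s t ∈ diffCube C) :
    ∃ c ∈ kPoints C, s * c ∈ kPoints C ∧ t * c ∈ kPoints C := by
  obtain ⟨_, ⟨c₀, hc₀, _, ⟨c₁, hc₁, c₂, hc₂, rfl⟩, rfl⟩, h⟩ := h
  rw [onPoints_Diff] at h
  have h₁ := congr(onPoints (fst A A) $h)
  have h₂ := congr(onPoints (snd A A) $h)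
  rw [onPoints_fst_kPair, onPoints_fst_kPair] at h₁
  rw [onPoints_snd_kPair, onPoints_snd_kPair] at h₂
  rw [← h₁, ← h₂]
  exact ⟨c₀, hc₀, by rwa [div_mul_cancel], by rwa [div_mul_cancel]⟩

variable {k : Type u} [Field k] [IsAlgClosed k]

/-- The join is the image of the proper scheme `X ⊗ Y` under (x, y) ↦ f(x) g(y). -/
lemma isClosed_range_sup_range {X Y A : Over (Spec (.of k))} [GrpObj X] [GrpObj Y] [GrpObj A]
    [IsProper X.hom] [IsProper Y.hom] [IsProper A.hom] [IsCommMonObj A] (f : X ⟶ A) (g : Y ⟶ A)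
    [IsMonHom f] [IsMonHom g] :
    IsClosed (((onPointsHom f).range ⊔ (onPointsHom g).range : Subgroup (KPoint A)) :
      Set (KPoint A)) := by
  convert! isClosed_range_onPoints ((fst X Y ≫ f) * (snd X Y ≫ g)) using 1
  ext P
  rw [SetLike.mem_coe, Subgroup.mem_sup]
  constructor
  · rintro ⟨_, ⟨x, rfl⟩, _, ⟨y, rfl⟩, rfl⟩
    refine ⟨kPair x y, ?_⟩
    simp [onPoints, kPair, MonObj.comp_mul, onPointsHom_apply]
  · rintro ⟨Q, rfl⟩
    refine ⟨_, ⟨onPoints (fst X Y) Q, rfl⟩, _, ⟨onPoints (snd X Y) Q, rfl⟩, ?_⟩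
    simp [onPoints, MonObj.comp_mul, onPointsHom_apply]

/-- A closed subgroup of `A²` that contains the square of a curve through the identity that lies in no
proper coset is everything. -/
lemma eq_top_of_forall_kPair_mem {A : Over (Spec (.of k))} [GrpObj A] [IsProper A.hom]
    [IsCommMonObj A] {C : Set A.left} (hC : IsClosedCurve C)
    (hcoset : ∀ S : Set (KPoint A), IsProperCoset S → ¬ kPoints C ⊆ S) {P : KPoint A}
    (hP : P ∈ kPoints C) (E : Subgroup (KPoint (A ⊗ A))) (hEc : IsClosed (E : Set (KPoint (A ⊗ A))))
    (hSE : ∀ s t, s * P ∈ kPoints C → t * P ∈ kPoints C → kPair s t ∈ E) : E = ⊤ := by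
  have h1 : 1 * P ∈ kPoints C := by rwa [_root_.one_mul]
  let inl : KPoint A →* KPoint (A ⊗ A) :=
    { toFun := fun a ↦ kPair a 1
      map_one' := kPair_one_one A A
      map_mul' := fun a b ↦ by rw [kPair_mul, _root_.mul_one] }
  let inr : KPoint A →* KPoint (A ⊗ A) :=
    { toFun := fun a ↦ kPair 1 a
      map_one' := kPair_one_one A A
      map_mul' := fun a b ↦ by rw [kPair_mul, _root_.mul_one] }
  -- Since `C - P` contains the identity, `E` contains a copy of it in each factor of A², and each
  -- factor is treated separately.
  have hinl : E.comap inl = ⊤ := eq_top_of_curve_subset hC hcoset hP _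
    (hEc.preimage (continuous_kPair_left 1)) fun x hx ↦ hSE x 1 hx h1
  have hinr : E.comap inr = ⊤ := eq_top_of_curve_subset hC hcoset hP _
    (hEc.preimage (continuous_kPair_right 1)) fun x hx ↦ hSE 1 x h1 hx
  refine eq_top_iff.2 fun x _ ↦ ?_
  have h₁ : inl (onPoints (fst A A) x) ∈ E := hinl.ge (Subgroup.mem_top _)
  have h₂ : inr (onPoints (snd A A) x) ∈ E := hinr.ge (Subgroup.mem_top _)
  have h : inl (onPoints (fst A A) x) * inr (onPoints (snd A A) x) = x := by
    refine (kPair_mul _ _ _ _).trans (kPoint_tensor_ext ?_ ?_)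
    · rw [onPoints_fst_kPair, _root_.mul_one]
    · rw [onPoints_snd_kPair, _root_.one_mul]
  exact h ▸ E.mul_mem h₁ h₂

/-- If the ranges of `f` and `g` generate the target and `p` is onto, then `p ∘ g` is nontrivial
unless `p ∘ f` is onto. -/
lemma nontrivial_range_of_sup_eq_top {L M N R : Type*} [Group L] [Group M] [CommGroup N] [Group R]
    {f : L →* N} {g : M →* N} (h : f.range ⊔ g.range = ⊤) {p : N →* R}
    (hp : Function.Surjective p) (hf : ¬ Function.Surjective (p.comp f)) :
    ((p.comp g).range : Set R).Nontrivial := by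
  by_contra hn
  rw [Set.not_nontrivial_iff] at hn
  refine hf fun a ↦ ?_
  obtain ⟨x, rfl⟩ := hp a
  obtain ⟨_, ⟨y, rfl⟩, _, ⟨b, rfl⟩, rfl⟩ := Subgroup.mem_sup.1 (h.ge (Subgroup.mem_top x))
  have hb : p (g b) = 1 := hn ⟨b, rfl⟩ (p.comp g).range.one_mem
  exact ⟨y, by simp [hb]⟩

/-- A set of the form `Z * B * {Q}` that contains `1`, where `B` is a subgroup, contains `B`. -/
lemma subset_mul_mul_singleton {M : Type*} [CommGroup M] {Z : Set M} {B : Subgroup M} {Q : M}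
    (h1 : 1 ∈ Z * (B : Set M) * {Q}) : (B : Set M) ⊆ Z * (B : Set M) * {Q} := by
  obtain ⟨_, ⟨z, hz, b₀, hb₀, rfl⟩, _, rfl, h⟩ := h1
  intro b hb
  refine ⟨_, ⟨z, hz, b₀ * b, B.mul_mem hb₀ hb, rfl⟩, _, rfl, ?_⟩
  beta_reduce at h ⊢
  rw [← _root_.mul_assoc, mul_right_comm, h, _root_.one_mul]

/-- A subgroup `E` containing `Z` and `B` contains `Z * B * {Q}` if the latter contains `1`. -/
lemma mul_mul_singleton_subset {M : Type*} [Group M] {Z B : Set M} {Q : M} {E : Subgroup M}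
    (hZ : Z ⊆ E) (hB : B ⊆ E) (h1 : 1 ∈ Z * B * {Q}) : Z * B * {Q} ⊆ E := by
  obtain ⟨_, ⟨z, hz, b, hb, rfl⟩, _, rfl, h⟩ := h1
  rintro _ ⟨_, ⟨z', hz', b', hb', rfl⟩, _, rfl, rfl⟩
  refine E.mul_mem (E.mul_mem (hZ hz') (hB hb')) ?_
  beta_reduce at h
  exact (E.mul_mem_cancel_left (E.mul_mem (hZ hz) (hB hb))).1 (h ▸ E.one_mem)

/-- A translation-invariant form of `exists_subgroup_of_curve`. -/
theorem exists_subgroup_of_curve_translate {M : Type*} [CommGroup M] [TopologicalSpace M]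
    [SeparatelyContinuousMul M] [ContinuousInv M] [T1Space M] [TopologicalSpace.NoetherianSpace M]
    {C : Set M} (hCc : IsClosed C) {P : M} (hP : P ∈ C)
    (hC : ∀ T : Set M, IsClosed T → IsIrreducible T → T.Nontrivial → T ⊆ C → T = C)
    (K₁ K₂ : Subgroup M) (hK₁ : IsIrreducible (K₁ : Set M)) (hK₂ : IsIrreducible (K₂ : Set M))
    (hn₁ : (K₁ : Set M).Nontrivial) (hn₂ : (K₂ : Set M).Nontrivial)
    (h : ∀ s ∈ K₁, ∀ t ∈ K₂, ∃ c ∈ C, s * c ∈ C ∧ t * c ∈ C) :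
    ∃ V : Subgroup M, IsClosed (V : Set M) ∧ ∀ x, x ∈ V ↔ x * P ∈ C := by
  have hSc : IsClosed ((· * P) ⁻¹' C) := hCc.preimage (continuous_mul_const P)
  obtain ⟨V, hV⟩ := exists_subgroup_of_curve hSc (by simpa using hP) (fun T hTc hTi hT hTS ↦ by
      have himg : (· * P) '' T = C := by
        refine hC _ ?_ (hTi.image _ (continuous_mul_const P).continuousOn)
          (hT.image (mul_left_injective P)) (Set.image_subset_iff.2 hTS)
        rw [Set.image_mul_right]
        exact hTc.preimage (continuous_mul_const _)
      refine hTS.antisymm fun x hx ↦ ?_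
      obtain ⟨y, hy, hxy⟩ := himg.ge hx
      exact mul_right_cancel hxy ▸ hy)
    K₁ K₂ hK₁ hK₂ hn₁ hn₂ (fun s hs t ht ↦ by
      obtain ⟨c, hc, hsc, htc⟩ := h s hs t ht
      have key (s : M) : c * P⁻¹ * s * P = s * c := by
        rw [mul_right_comm, inv_mul_cancel_right, mul_comm]
      exact ⟨c * P⁻¹, by simpa using hc, by simpa [key] using hsc, by simpa [key] using htc⟩)
  exact ⟨V, hV ▸ hSc, fun x ↦ by rw [← SetLike.mem_coe, hV]; rfl⟩

end FaltingsZhang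

theorem mainTheorem8 {k : Type u} [Field k] [IsAlgClosed k]
    -- the abelian variety `A` and the curve `C ⊂ A`
    (A : Over (Spec (.of k))) [GrpObj A] [IsAbelianVariety A]
    (C : Set A.left) (hC : IsClosedCurve C) (hCA : C ≠ Set.univ)
    (hcoset : ∀ S : Set (KPoint A), IsProperCoset S → ¬ kPoints C ⊆ S)
    -- the abelian subvariety `i : H ↪ A`, not equal to `A`
    (H : Over (Spec (.of k))) [GrpObj H] [IsAbelianVariety H]
    (i : H ⟶ A) [IsMonHom i] [IsClosedImmersion i.left] (hHA : ¬ Surjective i.left)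
    -- the homomorphism `ψ : A → H` whose restriction to `H` is an isogeny
    (ψ : A ⟶ H) [IsMonHom ψ] (hψ : IsIsogeny (i ≫ ψ))
    -- the abelian subvariety `B` of `A²`, contained in the kernel of `ψ × ψ`
    (B : Set (KPoint (A ⊗ A))) (hB : IsAbelianSubvariety B)
    (hBψ : ∀ b ∈ B, onPoints (ψ ⊗ₘ ψ) b = 1)
    -- the irreducible closed subvariety `Z` of `H²`, and the point `(Q₁, Q₂)`
    (Z : Set (H ⊗ H).left) (hZ : IsClosedSubvariety Z) (Q₁ Q₂ : KPoint A)
    (hZB : (onPoints (i ⊗ₘ i) '' kPoints Z) * B * {kPair Q₁ Q₂} ⊆ diffCube C) :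
    ∀ P ∈ kPoints C,
      ¬ translateSq C P ⊆ (onPoints (i ⊗ₘ i) '' kPoints Z) * B * {kPair Q₁ Q₂} := by
  intro P hP hsub
  obtain ⟨G, _, hG, j, hj, -, rfl⟩ := hB
  have := IsAbelianVariety.isProper (A := A)
  have := IsAbelianVariety.geometricallyIntegral (A := A)
  have := IsAbelianVariety.isProper (A := H)
  have := IsAbelianVariety.isProper (A := G)
  have := IsAbelianVariety.geometricallyIntegral (A := G)
  have : IsCommMonObj A := isCommMonObj_of_isProper_of_geometricallyIntegral A
  have : TopologicalSpace.NoetherianSpace A.left := noetherianSpace_left A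
  have : TopologicalSpace.NoetherianSpace (KPoint A) := (isInducing_toPoint A).noetherianSpace
  have hCc : IsClosed (kPoints C) := isClosed_kPoints hC.isClosed
  have hSW (s t : KPoint A) (hs : s * P ∈ kPoints C) (ht : t * P ∈ kPoints C) :
      kPair s t ∈ (onPoints (i ⊗ₘ i) '' kPoints Z) * Set.range (onPoints j) * {kPair Q₁ Q₂} :=
    hsub ⟨s, ⟨_, hs, _, rfl, mul_inv_cancel_right s P⟩,
      t, ⟨_, ht, _, rfl, mul_inv_cancel_right t P⟩, rfl⟩
  have hP1 : 1 * P ∈ kPoints C := by rwa [_root_.one_mul]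
  have h1W := hSW 1 1 hP1 hP1
  rw [kPair_one_one] at h1W
  -- `H² + B` contains `(C - P)²`, hence is equal to `A²`
  set E : Subgroup (KPoint (A ⊗ A)) := (onPointsHom (i ⊗ₘ i)).range ⊔ (onPointsHom j).range
  have hEc : IsClosed (E : Set (KPoint (A ⊗ A))) := isClosed_range_sup_range _ _
  have hWE := mul_mul_singleton_subset (E := E)
    (by rintro _ ⟨x, -, rfl⟩; exact Subgroup.mem_sup_left ⟨x, rfl⟩)
    (by rintro _ ⟨x, rfl⟩; exact Subgroup.mem_sup_right ⟨x, rfl⟩) h1W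
  have hE : E = ⊤ := eq_top_of_forall_kPair_mem hC hcoset hP E hEc
    fun s t hs ht ↦ hWE (hSW s t hs ht)
  -- `B` contains the product of its projections `K₁` and `K₂`, which are nontrivial
  let p₁ : KPoint G →* KPoint A := (onPointsHom (fst A A)).comp (onPointsHom j)
  let p₂ : KPoint G →* KPoint A := (onPointsHom (snd A A)).comp (onPointsHom j)
  have hirr (p : KPoint G →* KPoint A) (hp : Continuous p) :
      IsIrreducible (p.range : Set (KPoint A)) := by
    rw [MonoidHom.coe_range, ← Set.image_univ]
    exact (isIrreducible_univ_kPoint G).image p hp.continuousOn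
  have hi : ¬ Function.Surjective (onPoints i) := fun h ↦ hHA (surjective_left_of_onPoints i h)
  -- If this projection of `B` were trivial, H² alone would project onto A, so H would be A.
  have hp₁ : (p₁.range : Set (KPoint A)).Nontrivial := by
    refine nontrivial_range_of_sup_eq_top hE (p := onPointsHom (fst A A))
      (fun a ↦ ⟨kPair a 1, onPoints_fst_kPair a 1⟩) fun h ↦ hi fun a ↦ ?_
    obtain ⟨x, rfl⟩ := h a
    exact ⟨onPoints (fst H H) x, (onPoints_fst_tensorHom i i x).symm⟩
  have hp₂ : (p₂.range : Set (KPoint A)).Nontrivial := by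
    refine nontrivial_range_of_sup_eq_top hE (p := onPointsHom (snd A A))
      (fun a ↦ ⟨kPair 1 a, onPoints_snd_kPair 1 a⟩) fun h ↦ hi fun a ↦ ?_
    obtain ⟨x, rfl⟩ := h a
    exact ⟨onPoints (snd H H) x, (onPoints_snd_tensorHom i i x).symm⟩
  -- `K₁ × K₂` lies in the difference variety of `C`
  have hdiff : ∀ s ∈ p₁.range, ∀ t ∈ p₂.range,
      ∃ c ∈ kPoints C, s * c ∈ kPoints C ∧ t * c ∈ kPoints C := by
    rintro _ ⟨b₁, rfl⟩ _ ⟨b₂, rfl⟩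
    exact exists_mul_mem_of_mem_diffCube <| hZB <|
      subset_mul_mul_singleton (B := (onPointsHom j).range) h1W
        (kPair_mem_of_sup_eq_top hψ (fun b ↦ hBψ _ ⟨b, rfl⟩) hE b₁ b₂)
  -- hence `C - P` is a subgroup
  obtain ⟨V, hVc, hV⟩ := exists_subgroup_of_curve_translate hCc hP (fun T ↦ hC.eq_of_subset)
    p₁.range p₂.range
    (hirr p₁ ((continuous_onPoints (fst A A)).comp (continuous_onPoints j)))
    (hirr p₂ ((continuous_onPoints (snd A A)).comp (continuous_onPoints j))) hp₁ hp₂ hdiff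
  have hVtop := eq_top_of_curve_subset hC hcoset hP V hVc fun x hx ↦ (hV x).2 hx
  have hCuniv : kPoints C = kPoints Set.univ := by
    refine Set.eq_univ_of_forall fun x ↦ ?_
    have h : x * P⁻¹ * P ∈ kPoints C := (hV _).1 (hVtop ▸ Subgroup.mem_top _)
    rwa [inv_mul_cancel_right] at h
  exact hCA (by rw [← closure_image_kPoints hC.isClosed, hCuniv, closure_image_kPoints isClosed_univ])
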